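/- Let $\Delta=\{(b,a)\in\mathbb R^2 : b\in(1,2),\ a\in[0,2-b]\}$. For $\beta\in(1,2]$ and $\alpha\in[0,2-\beta]$ let $T_{\beta,\alpha}(x)=\beta x+\alpha \bmod 1$ on $[0,1]$ and $p=(1-\alpha)/\beta$, and let $T^-_{\beta,\alpha}(x)=\beta x+\alpha$ if $x\le p$ and $T^-_{\beta,\alpha}(x)=\beta x+\alpha-1$ otherwise. The upper expansion $\tau^+_{\beta,\alpha}(x)=\omega_1\omega_2\cdots\in\{0,1\}^{\mathbb N}$ has $\omega_n=0$ if $T_{\beta,\alpha}^{n-1}(x)<p$ and $\omega_n=1$ otherwise; the lower expansion $\tau^-_{\beta,\alpha}(x)$ has $n$-th letter $0$ if $(T^-_{\beta,\alpha})^{n-1}(x)\le p$ and $1$ otherwise (for $x\in(0,1]$ it equals $\lim_{y\nearrow x}\tau^+_{\beta,\alpha}(y)$). Put $\pi_{\beta,\alpha}(\omega)=\frac{\alpha}{1-\beta}+\sum_{k\ge1}\omega_k\beta^{-k}$, and $$K^+_{\beta,\alpha}(t)=\{x\in[0,1): T_{\beta,\alpha}^n(x)\notin[0,t)\ \text{for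 all } n\ge0\},\qquad E^+_{\beta,\alpha}=\{t\in[0,1): T_{\beta,\alpha}^n(t)\notin[0,t)\ \text{for all } n\ge0\}.$$ When $\alpha=0$ the index $\alpha$ is omitted: $\tau_\beta^-=\tau_{\beta,0}^-$, $\pi_\beta=\pi_{\beta,0}$, $K^+_\beta=K^+_{\beta,0}$, $E^+_\beta=E^+_{\beta,0}$. Let $(\beta,\alpha)\in\Delta$. There is a unique $\beta'=u(\beta,\alpha)\in(1,2]$ with $\tau^-_{\beta,\alpha}(1)=\tau^-_{\beta'}(1)$, and $\beta'<2$ if and only if $\alpha<2-\beta$. With $\tilde\pi=\pi_{\beta'}\circ\tau^+_{\beta,\alpha}$ the following hold. 1. $\tilde\pi([0,1))=K^+_{\beta'}(\tilde\pi(0))$ and $\tilde\pi(E^+_{\beta,\alpha})=E^+_{\beta'}\cap[\tilde\pi(0),1]$. 2. For every $x\in E^+_{\beta,\alpha}$, the point $x$ is isolated in $E^+_{\beta,\alpha}$ if and only if $\tilde\pi(x)$ is isolated in $E^+_{\beta'}$. 3. For every $t\in(0,1)$, $\tilde\pi(K^+_{\beta,\alpha}(t))=K^+_{\beta'}(\tilde\pi(t))$.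 4. For every $t\in(0,1)$, $\dim_H K^+_{\beta,\alpha}(t)=\dfrac{\log\beta'}{\log\beta}\,\dim_H K^+_{\beta'}(\tilde\pi(t))$. -/

import Mathlib

open Set Filter Topology

/-- The parameter set `Δ = {(b, a) : b ∈ (1, 2), a ∈ [0, 2 - b]}`. -/
def betaParam : Set (ℝ × ℝ) := {q | 1 < q.1 ∧ q.1 < 2 ∧ 0 ≤ q.2 ∧ q.2 ≤ 2 - q.1}

/-- The intermediate `β`-transformation `T_{β,α} : x ↦ βx + α mod 1`. -/
noncomputable def betaT (β α : ℝ) (x : ℝ) : ℝ := Int.fract (β * x + α)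

/-- The critical point `p_{β,α} = (1 - α) / β`. -/
noncomputable def betaCrit (β α : ℝ) : ℝ := (1 - α) / β

open Classical in
/-- The lower transformation `T⁻_{β,α}`: `x ↦ βx + α` if `x ≤ p`, and `x ↦ βx + α - 1` otherwise. -/
noncomputable def betaTLower (β α : ℝ) (x : ℝ) : ℝ :=
  if x ≤ betaCrit β α then β * x + α else β * x + α - 1

open Classical in
/-- The upper expansion `τ⁺_{β,α}(x)`. Words are indexed from `0`: the entry with index `n` is the
letter `ω_{n+1}`, which is `0` if `T^n(x) < p` and `1` otherwise. -/
noncomputable def upperExp (β α : ℝ) (x : ℝ) : ℕ → Fin 2 :=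
  fun n => if (betaT β α)^[n] x < betaCrit β α then 0 else 1

open Classical in
/-- The lower expansion `τ⁻_{β,α}(x)`: the letter `ω_{n+1}` is `0` if `(T⁻)^n(x) ≤ p` and `1`
otherwise. It is the limit of `τ⁺_{β,α}(y)` as `y` increases to `x`: see `upperExp_tendsto`. -/
noncomputable def lowerExp (β α : ℝ) (x : ℝ) : ℕ → Fin 2 :=
  fun n => if (betaTLower β α)^[n] x ≤ betaCrit β α then 0 else 1

/-- The projection `π_{β,α}(ω) = α / (1 - β) + ∑_{k ≥ 1} ω_k β^{-k}`. -/
noncomputable def betaProj (β α : ℝ) (ω : ℕ → Fin 2) : ℝ :=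
  α / (1 - β) + ∑' k : ℕ, ((ω k : ℕ) : ℝ) / β ^ (k + 1)

/-- The survivor set `K⁺_{β,α}(t) = {x ∈ [0,1) : T^n(x) ∉ [0,t) for all n ≥ 0}`. -/
def survivorSet (β α t : ℝ) : Set ℝ :=
  {x | x ∈ Ico (0 : ℝ) 1 ∧ ∀ n : ℕ, (betaT β α)^[n] x ∉ Ico (0 : ℝ) t}

/-- The bifurcation set `E⁺_{β,α} = {t ∈ [0,1) : T^n(t) ∉ [0,t) for all n ≥ 0}`. -/
def bifurcationSet (β α : ℝ) : Set ℝ :=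
  {t | t ∈ Ico (0 : ℝ) 1 ∧ ∀ n : ℕ, (betaT β α)^[n] t ∉ Ico (0 : ℝ) t}

/-- `β' = u(β,α)`: the base `β' ∈ (1, 2]` for which the quasi-greedy `β'`-expansion of `1` is
the lower expansion `τ⁻_{β,α}(1)`. -/
def IsGreedyBase (β α β' : ℝ) : Prop :=
  1 < β' ∧ β' ≤ 2 ∧ lowerExp β α 1 = lowerExp β' 0 1

/-- The map `π_{β'} ∘ τ⁺_{β,α}`, where `π_{β'} = π_{β',0}`. -/
noncomputable def greedyMap (β α β' : ℝ) (x : ℝ) : ℝ := betaProj β' 0 (upperExp β α x)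

/-- `x` is an isolated point of the set `S` of reals. -/
def IsIsolatedIn (x : ℝ) (S : Set ℝ) : Prop :=
  x ∈ S ∧ ∃ ε > 0, ∀ y ∈ S, |y - x| < ε → y = x

theorem betaTLower_mem {β α x : ℝ} (hβ : 1 < β) (hα : 0 ≤ α) (hα' : α ≤ 2 - β)
    (hx : x ∈ Ioc (0 : ℝ) 1) : betaTLower β α x ∈ Ioc (0 : ℝ) 1 := by
  obtain ⟨h0, h1⟩ := hx
  have hb : 0 < β := by linarith
  unfold betaTLower betaCrit
  split_ifs with h
  · rw [le_div_iff₀ hb] at h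
    exact ⟨by nlinarith, by nlinarith⟩
  · rw [not_le, div_lt_iff₀ hb] at h
    exact ⟨by nlinarith, by nlinarith⟩

theorem betaT_tendsto {β α x : ℝ} (hβ : 1 < β) (hα : 0 ≤ α) (hα' : α ≤ 2 - β)
    (hx : x ∈ Ioc (0 : ℝ) 1) :
    Tendsto (betaT β α) (𝓝[<] x) (𝓝[<] (betaTLower β α x)) := by
  obtain ⟨h0, h1⟩ := hx
  have hb : 0 < β := by linarith
  have key : ∀ c : ℝ, Tendsto (fun y => β * y + α - c) (𝓝[<] x) (𝓝[<] (β * x + α - c)) := by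
    intro c
    refine tendsto_nhdsWithin_iff.2 ⟨?_, ?_⟩
    · have : Continuous (fun y : ℝ => β * y + α - c) := by fun_prop
      exact (this.tendsto x).mono_left nhdsWithin_le_nhds
    · filter_upwards [self_mem_nhdsWithin] with y hy
      have : y < x := hy
      simp only [mem_Iio]
      nlinarith
  unfold betaTLower betaCrit
  split_ifs with h
  · rw [le_div_iff₀ hb] at h
    have := key 0
    simp only [sub_zero] at this
    refine this.congr' ?_
    filter_upwards [self_mem_nhdsWithin, mem_nhdsWithin_of_mem_nhds (lt_mem_nhds h0)] with y hy hy0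
    have hy' : y < x := hy
    exact (Int.fract_eq_self.2 ⟨by positivity, by nlinarith⟩).symm
  · rw [not_le] at h
    refine (key 1).congr' ?_
    filter_upwards [self_mem_nhdsWithin, mem_nhdsWithin_of_mem_nhds (lt_mem_nhds h)] with y hy hyp
    have hy' : y < x := hy
    rw [div_lt_iff₀ hb] at hyp
    refine (Int.fract_eq_iff.2 ⟨by nlinarith, by nlinarith, 1, by push_cast; ring⟩).symm

/-- The lower expansion is the left limit of the upper expansion, in the product topology. -/
theorem upperExp_tendsto {β α x : ℝ} (hβ : 1 < β) (hα : 0 ≤ α) (hα' : α ≤ 2 - β)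
    (hx : x ∈ Ioc (0 : ℝ) 1) :
    Tendsto (upperExp β α) (𝓝[<] x) (𝓝 (lowerExp β α x)) := by
  have hmem : ∀ n : ℕ, (betaTLower β α)^[n] x ∈ Ioc (0 : ℝ) 1 := by
    intro n
    induction n with
    | zero => exact hx
    | succ k ih =>
      rw [Function.iterate_succ_apply']
      exact betaTLower_mem hβ hα hα' ih
  have hlim : ∀ n : ℕ, Tendsto ((betaT β α)^[n]) (𝓝[<] x) (𝓝[<] ((betaTLower β α)^[n] x)) := by
    intro n
    induction n with
    | zero => exact tendsto_id
    | succ k ih =>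
      rw [Function.iterate_succ', Function.iterate_succ']
      exact (betaT_tendsto hβ hα hα' (hmem k)).comp ih
  refine tendsto_pi_nhds.2 fun n => tendsto_nhds_of_eventually_eq ?_
  unfold upperExp lowerExp
  split_ifs with h
  · filter_upwards [(hlim n).eventually self_mem_nhdsWithin] with y hy
    exact if_pos (lt_of_lt_of_le hy h)
  · filter_upwards [(hlim n).eventually
      (mem_nhdsWithin_of_mem_nhds (lt_mem_nhds (not_le.1 h)))] with y hy
    exact if_neg (not_lt.2 (le_of_lt hy))

/-!
Both systems are read through their symbolic codings. A word is an upper expansion for `(β, α)`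
exactly when all its shifts lie, lexicographically, at or above `τ⁺(0)` and strictly below `τ⁻(1)`
(`exists_upperExp_eq` is the nontrivial direction): at the first place where a shift differs from
`τ⁻(1)`, the excess over `1` of the point it codes is at most `β ^ (-(j + 1))` times the excess of a
later point, so a bounded orbit has no excess at all. Since `x < y` if and only if
`τ⁺(x) < τ⁺(y)`, all sets in the theorem are described by inequalities between words.

The base `β'` is the root in `(1, 2]` of `∑_{k ≥ 1} κ_k b ^ (-k) = 1` with `κ = τ⁻_{β,α}(1)`. The sum is
strictly decreasing in `b`, at least `1` at `b = β` and at most `1` at `b = 2`; the inequalities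
`σⁿκ ≤ κ` make `κ` the quasi-greedy expansion of `1` in base `β'`. The two systems then have the same
upper bound on words, while the lower bound for `(β', 0)` is the zero word. Hence every expansion
for `(β, α)` is one for `β'`, and `greedyMap` is an increasing conjugacy onto the points whose
orbits stay at or above the image of `0`. The descriptions of survivor and bifurcation sets follow.

For the dimensions: two points of a survivor set with hole `[0, t)`, `t > 0`, whose expansions share
exactly `n` letters are at distance comparable to `β ^ (-n)`, since the hole is adjacent to the image
`0` of the critical point. So the conjugacy and its inverse are Hölder with exponents
`log β' / log β` and its reciprocal (`dimH_image_le_of_upperExp_eq`).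

For isolated points: the orbit of a positive bifurcation point avoids the critical point, so the
coding is continuous there, and isolation transfers through the conjugacy and its inverse. The point
`0` needs an argument of its own, as bifurcation points of `β'` may lie to the left of its image: it
is never isolated (`not_isIsolatedIn_zero`), because otherwise the branches at `0` of the iterates
could not shrink exponentially.
-/

/-! ### Affine orbits and their symbolic codings -/

/-- The standing assumptions on the parameters, including the doubling map `(β, α) = (2, 0)`. -/
structure IsBetaPair (β α : ℝ) : Prop where
  one_lt : 1 < β
  nonneg : 0 ≤ α
  le : α ≤ 2 - β

/-- `x` is a sequence of points following the branches `x ↦ β x + α - ω_n` prescribed by the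
letters of `ω`. Nothing is required of the location of the points, so both the upper and the lower
expansions, and formal orbits which are not known to lie in `[0, 1]`, are covered. -/
def IsCodedOrbit (β α : ℝ) (ω : ℕ → Fin 2) (x : ℕ → ℝ) : Prop :=
  ∀ n, x (n + 1) = β * x n + α - ((ω n : ℕ) : ℝ)

theorem fin_two_eq (a : Fin 2) : a = 0 ∨ a = 1 := by omega

theorem toLex_lt_iff_exists {ω ν : ℕ → Fin 2} :
    toLex ω < toLex ν ↔ ∃ n, (∀ k < n, ω k = ν k) ∧ ω n = 0 ∧ ν n = 1 := by
  refine exists_congr fun n => and_congr Iff.rfl ?_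
  have h : ∀ a b : Fin 2, a < b ↔ a = 0 ∧ b = 1 := by decide
  exact h _ _

namespace IsBetaPair

variable {β α : ℝ}

theorem pos (h : IsBetaPair β α) : 0 < β := by linarith [h.one_lt]

theorem le_two (h : IsBetaPair β α) : β ≤ 2 := by linarith [h.nonneg, h.le]

theorem alpha_lt_one (h : IsBetaPair β α) : α < 1 := by linarith [h.one_lt, h.le]

theorem crit_pos (h : IsBetaPair β α) : 0 < betaCrit β α :=
  div_pos (by linarith [h.alpha_lt_one]) h.pos

theorem crit_lt_one (h : IsBetaPair β α) : betaCrit β α < 1 := by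
  rw [betaCrit, div_lt_one h.pos]
  linarith [h.one_lt, h.nonneg]

theorem mul_crit (h : IsBetaPair β α) : β * betaCrit β α + α = 1 := by
  rw [betaCrit, mul_div_cancel₀ _ h.pos.ne']
  ring

theorem lt_crit_iff (h : IsBetaPair β α) {x : ℝ} : x < betaCrit β α ↔ β * x + α < 1 := by
  rw [betaCrit, lt_div_iff₀ h.pos]
  constructor <;> intro <;> linarith

theorem le_crit_iff (h : IsBetaPair β α) {x : ℝ} : x ≤ betaCrit β α ↔ β * x + α ≤ 1 := by
  rw [betaCrit, le_div_iff₀ h.pos]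
  constructor <;> intro <;> linarith

end IsBetaPair

theorem isBetaPair_zero {β : ℝ} (h1 : 1 < β) (h2 : β ≤ 2) : IsBetaPair β 0 :=
  ⟨h1, le_rfl, by linarith⟩

section Orbits

variable {β α : ℝ} {ω ν : ℕ → Fin 2} {x y : ℕ → ℝ}

theorem IsCodedOrbit.shift (h : IsCodedOrbit β α ω x) (n : ℕ) :
    IsCodedOrbit β α (fun k => ω (k + n)) (fun k => x (k + n)) := by
  intro k
  have := h (k + n)
  rwa [add_right_comm] at this

theorem IsCodedOrbit.sub_eq (hx : IsCodedOrbit β α ω x) (hy : IsCodedOrbit β α ν y) {n : ℕ}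
    (h : ∀ k < n, ω k = ν k) : x n - y n = β ^ n * (x 0 - y 0) := by
  induction n with
  | zero => simp
  | succ n ih =>
    rw [hx n, hy n, h n n.lt_succ_self, pow_succ, mul_right_comm,
      ← ih fun k hk => h k (hk.trans n.lt_succ_self)]
    ring

theorem norm_letter_div_le (hβ : 1 < β) (ω : ℕ → Fin 2) (k : ℕ) :
    ‖((ω k : ℕ) : ℝ) / β ^ (k + 1)‖ ≤ β⁻¹ * β⁻¹ ^ k := by
  have h0 : 0 < β := by linarith
  have h1 : ((ω k : ℕ) : ℝ) ≤ 1 := by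
    rcases fin_two_eq (ω k) with h | h <;> simp [h]
  rw [Real.norm_of_nonneg (by positivity), ← pow_succ', inv_pow, div_eq_mul_inv]
  exact mul_le_of_le_one_left (by positivity) h1

theorem hasSum_inv_pow_succ (hβ : 1 < β) : HasSum (fun k : ℕ => β⁻¹ * β⁻¹ ^ k) (1 / (β - 1)) := by
  have h0 : 0 < β := by linarith
  have := (hasSum_geometric_of_lt_one (inv_nonneg.2 h0.le) (inv_lt_one_of_one_lt₀ hβ)).mul_left β⁻¹
  rw [one_div]
  rwa [← mul_inv, mul_sub, mul_inv_cancel₀ h0.ne', mul_one] at this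

theorem summable_letter_div (hβ : 1 < β) (ω : ℕ → Fin 2) :
    Summable fun k => ((ω k : ℕ) : ℝ) / β ^ (k + 1) :=
  (hasSum_inv_pow_succ hβ).summable.of_norm_bounded (norm_letter_div_le hβ ω)

theorem tsum_letter_div_mem (hβ : 1 < β) (ω : ℕ → Fin 2) :
    ∑' k, ((ω k : ℕ) : ℝ) / β ^ (k + 1) ∈ Icc (0 : ℝ) (1 / (β - 1)) := by
  have h0 : 0 < β := by linarith
  refine ⟨tsum_nonneg fun k => by positivity, ?_⟩
  rw [← (hasSum_inv_pow_succ hβ).tsum_eq]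
  exact (summable_letter_div hβ ω).tsum_le_tsum
    (fun k => (le_abs_self _).trans (norm_letter_div_le hβ ω k)) (hasSum_inv_pow_succ hβ).summable

theorem isCodedOrbit_betaProj (hβ : 1 < β) (ω : ℕ → Fin 2) :
    IsCodedOrbit β α ω fun n => betaProj β α fun k => ω (k + n) := by
  intro n
  have h0 : β ≠ 0 := by linarith
  have h1 : 1 - β ≠ 0 := by linarith
  have h := (summable_letter_div hβ fun k => ω (k + n)).tsum_eq_zero_add
  have h2 : ∑' k, ((ω (k + 1 + n) : ℕ) : ℝ) / β ^ (k + 1 + 1)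
      = (∑' k, ((ω (k + (n + 1)) : ℕ) : ℝ) / β ^ (k + 1)) / β := by
    rw [← tsum_div_const]
    refine tsum_congr fun k => ?_
    rw [pow_succ, div_div, show k + 1 + n = k + (n + 1) by ring]
  simp only [betaProj]
  rw [h, h2, zero_add, zero_add]
  field_simp
  ring

theorem abs_betaProj_le (hβ : 1 < β) (ω : ℕ → Fin 2) :
    |betaProj β α ω| ≤ |α / (1 - β)| + 1 / (β - 1) := by
  have h := tsum_letter_div_mem hβ ω
  refine (abs_add_le _ _).trans (add_le_add le_rfl ?_)
  rw [abs_of_nonneg h.1]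
  exact h.2

/-- A bounded coded orbit is determined by its letters. -/
theorem IsCodedOrbit.eq_betaProj (hβ : 1 < β) (hx : IsCodedOrbit β α ω x) {C : ℝ}
    (hC : ∀ n, |x n| ≤ C) : x 0 = betaProj β α ω := by
  have hb : ∀ n, |x n - betaProj β α (fun k => ω (k + n))| ≤
      C + |α / (1 - β)| + 1 / (β - 1) := by
    intro n
    refine (abs_sub _ _).trans ?_
    rw [add_assoc]
    exact add_le_add (hC n) (abs_betaProj_le hβ _)
  have hs : ∀ n, x n - betaProj β α (fun k => ω (k + n)) = β ^ n * (x 0 - betaProj β α ω) :=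
    fun n => hx.sub_eq (isCodedOrbit_betaProj hβ ω) fun _ _ => rfl
  by_contra hne
  have hpos : 0 < |x 0 - betaProj β α ω| := abs_pos.2 (sub_ne_zero.2 hne)
  have ht := (tendsto_pow_atTop_atTop_of_one_lt hβ).atTop_mul_const hpos
  obtain ⟨n, hn⟩ := (ht.eventually_gt_atTop (C + |α / (1 - β)| + 1 / (β - 1))).exists
  have := hb n
  rw [hs n, abs_mul, abs_of_pos (by positivity)] at this
  linarith

theorem IsCodedOrbit.crit_le (h : IsBetaPair β α) (hx : IsCodedOrbit β α ω x)
    (h0 : ∀ n, 0 ≤ x n) {n : ℕ} (hn : ω n = 1) : betaCrit β α ≤ x n := by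
  have := hx n
  rw [hn] at this
  by_contra! hlt
  rw [h.lt_crit_iff] at hlt
  have := h0 (n + 1)
  norm_num at *
  linarith

theorem IsCodedOrbit.le_crit (h : IsBetaPair β α) (hx : IsCodedOrbit β α ω x)
    (h1 : ∀ n, x n ≤ 1) {n : ℕ} (hn : ω n = 0) : x n ≤ betaCrit β α := by
  have h2 := hx n
  rw [hn] at h2
  rw [h.le_crit_iff]
  have := h1 (n + 1)
  norm_num at h2
  linarith

/-- Orbits in `[0, 1]` are ordered as their codings, whichever convention is used at the critical
point. -/
theorem IsCodedOrbit.toLex_lt (h : IsBetaPair β α) (hx : IsCodedOrbit β α ω x)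
    (hy : IsCodedOrbit β α ν y) (hx1 : ∀ n, x n ∈ Icc (0 : ℝ) 1) (hy1 : ∀ n, y n ∈ Icc (0 : ℝ) 1)
    (hlt : x 0 < y 0) : toLex ω < toLex ν := by
  have hb : ∀ {z : ℝ}, z ∈ Icc (0 : ℝ) 1 → |z| ≤ 1 := fun hz =>
    abs_le.2 ⟨by linarith [hz.1], hz.2⟩
  rcases lt_trichotomy (toLex ω) (toLex ν) with hl | he | hg
  · exact hl
  · have he' : ω = ν := he
    subst he'
    have e1 := hx.eq_betaProj h.one_lt fun n => hb (hx1 n)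
    have e2 := hy.eq_betaProj h.one_lt fun n => hb (hy1 n)
    linarith
  · obtain ⟨n, hn, h0, h1⟩ := toLex_lt_iff_exists.1 hg
    have hd := hy.sub_eq hx hn
    have hp : 0 < β ^ n * (y 0 - x 0) := mul_pos (pow_pos h.pos n) (by linarith)
    have := hx.crit_le h (fun k => (hx1 k).1) h1
    have := hy.le_crit h (fun k => (hy1 k).2) h0
    linarith

end Orbits

/-! ### Upper and lower expansions -/

section Expansions

variable {β α : ℝ}

theorem betaT_mem (x : ℝ) : betaT β α x ∈ Ico (0 : ℝ) 1 :=
  ⟨Int.fract_nonneg _, Int.fract_lt_one _⟩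

theorem betaT_iterate_mem {x : ℝ} (hx : x ∈ Ico (0 : ℝ) 1) (n : ℕ) :
    (betaT β α)^[n] x ∈ Ico (0 : ℝ) 1 := by
  cases n with
  | zero => exact hx
  | succ n => rw [Function.iterate_succ_apply']; exact betaT_mem _

theorem betaT_of_lt (h : IsBetaPair β α) {x : ℝ} (h0 : 0 ≤ x) (hx : x < betaCrit β α) :
    betaT β α x = β * x + α := by
  rw [h.lt_crit_iff] at hx
  exact Int.fract_eq_self.2 ⟨add_nonneg (mul_nonneg h.pos.le h0) h.nonneg, hx⟩

theorem betaT_of_ge (h : IsBetaPair β α) {x : ℝ} (hx : betaCrit β α ≤ x) (h1 : x < 1) :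
    betaT β α x = β * x + α - 1 := by
  have h2 := h.mul_crit
  have h3 : 0 ≤ β * (x - betaCrit β α) := mul_nonneg h.pos.le (by linarith)
  have h4 : 0 < β * (1 - x) := mul_pos h.pos (by linarith)
  refine Int.fract_eq_iff.2 ⟨by linarith, by linarith [h.le], 1, by push_cast; ring⟩

theorem upperExp_shift (x : ℝ) (n : ℕ) :
    upperExp β α ((betaT β α)^[n] x) = fun k => upperExp β α x (k + n) := by
  funext k
  simp only [upperExp, Function.iterate_add_apply]

theorem lowerExp_shift (x : ℝ) (n : ℕ) :
    lowerExp β α ((betaTLower β α)^[n] x) = fun k => lowerExp β α x (k + n) := by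
  funext k
  simp only [lowerExp, Function.iterate_add_apply]

theorem upperExp_eq_zero_iff {x : ℝ} {n : ℕ} :
    upperExp β α x n = 0 ↔ (betaT β α)^[n] x < betaCrit β α := by
  unfold upperExp
  split_ifs with h <;> simp [h]

theorem upperExp_eq_one_iff {x : ℝ} {n : ℕ} :
    upperExp β α x n = 1 ↔ betaCrit β α ≤ (betaT β α)^[n] x := by
  rw [← not_lt, ← upperExp_eq_zero_iff]
  rcases fin_two_eq (upperExp β α x n) with h | h <;> simp [h]

theorem lowerExp_eq_one_iff {x : ℝ} {n : ℕ} :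
    lowerExp β α x n = 1 ↔ betaCrit β α < (betaTLower β α)^[n] x := by
  rw [← not_le]
  unfold lowerExp
  split_ifs with h <;> simp [h]

theorem isCodedOrbit_upper (h : IsBetaPair β α) {x : ℝ} (hx : x ∈ Ico (0 : ℝ) 1) :
    IsCodedOrbit β α (upperExp β α x) fun n => (betaT β α)^[n] x := by
  intro n
  have hm := betaT_iterate_mem (β := β) (α := α) hx n
  simp only [Function.iterate_succ_apply']
  unfold upperExp
  split_ifs with hc
  · rw [betaT_of_lt h hm.1 hc]; simp
  · rw [betaT_of_ge h (not_lt.1 hc) hm.2]; simp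

theorem betaTLower_iterate_mem (h : IsBetaPair β α) {x : ℝ} (hx : x ∈ Ioc (0 : ℝ) 1) (n : ℕ) :
    (betaTLower β α)^[n] x ∈ Ioc (0 : ℝ) 1 := by
  induction n with
  | zero => exact hx
  | succ n ih =>
    rw [Function.iterate_succ_apply']
    exact betaTLower_mem h.one_lt h.nonneg h.le ih

theorem isCodedOrbit_lower (x : ℝ) :
    IsCodedOrbit β α (lowerExp β α x) fun n => (betaTLower β α)^[n] x := by
  intro n
  simp only [Function.iterate_succ_apply']
  unfold lowerExp betaTLower
  split_ifs with hc <;> simp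

theorem betaProj_upperExp (h : IsBetaPair β α) {x : ℝ} (hx : x ∈ Ico (0 : ℝ) 1) :
    betaProj β α (upperExp β α x) = x :=
  ((isCodedOrbit_upper h hx).eq_betaProj h.one_lt (C := 1) fun n => by
    have := betaT_iterate_mem (β := β) (α := α) hx n
    exact abs_le.2 ⟨by linarith [this.1], this.2.le⟩).symm

theorem betaProj_lowerExp (h : IsBetaPair β α) {x : ℝ} (hx : x ∈ Ioc (0 : ℝ) 1) :
    betaProj β α (lowerExp β α x) = x :=
  ((isCodedOrbit_lower x).eq_betaProj h.one_lt (C := 1) fun n => by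
    have := betaTLower_iterate_mem h hx n
    exact abs_le.2 ⟨by linarith [this.1], this.2⟩).symm

theorem toLex_upperExp_lt_iff (h : IsBetaPair β α) {x y : ℝ} (hx : x ∈ Ico (0 : ℝ) 1)
    (hy : y ∈ Ico (0 : ℝ) 1) : toLex (upperExp β α x) < toLex (upperExp β α y) ↔ x < y := by
  have key : ∀ {x y : ℝ}, x ∈ Ico (0 : ℝ) 1 → y ∈ Ico (0 : ℝ) 1 → x < y →
      toLex (upperExp β α x) < toLex (upperExp β α y) := fun hx hy hlt =>
    (isCodedOrbit_upper h hx).toLex_lt h (isCodedOrbit_upper h hy)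
      (fun n => Ico_subset_Icc_self (betaT_iterate_mem hx n))
      (fun n => Ico_subset_Icc_self (betaT_iterate_mem hy n)) hlt
  refine ⟨fun hl => ?_, key hx hy⟩
  rcases lt_trichotomy x y with h1 | h1 | h1
  · exact h1
  · exact absurd hl (by rw [h1]; exact lt_irrefl _)
  · exact absurd hl (key hy hx h1).asymm

theorem toLex_upperExp_le_iff (h : IsBetaPair β α) {x y : ℝ} (hx : x ∈ Ico (0 : ℝ) 1)
    (hy : y ∈ Ico (0 : ℝ) 1) : toLex (upperExp β α x) ≤ toLex (upperExp β α y) ↔ x ≤ y := by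
  exact not_lt.symm.trans ((not_congr (toLex_upperExp_lt_iff h hy hx)).trans not_lt)

theorem toLex_upperExp_lt_lowerExp_one (h : IsBetaPair β α) {x : ℝ} (hx : x ∈ Ico (0 : ℝ) 1) :
    toLex (upperExp β α x) < toLex (lowerExp β α 1) :=
  (isCodedOrbit_upper h hx).toLex_lt h (isCodedOrbit_lower 1)
    (fun n => Ico_subset_Icc_self (betaT_iterate_mem hx n))
    (fun n => Ioc_subset_Icc_self (betaTLower_iterate_mem h ⟨one_pos, le_rfl⟩ n)) hx.2

theorem toLex_lowerExp_shift_le (h : IsBetaPair β α) (n : ℕ) :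
    toLex (fun k => lowerExp β α 1 (k + n)) ≤ toLex (lowerExp β α 1) := by
  have hm := betaTLower_iterate_mem h (x := 1) ⟨one_pos, le_rfl⟩ n
  rw [← lowerExp_shift]
  rcases hm.2.eq_or_lt with he | hlt
  · rw [he]
  · refine ((isCodedOrbit_lower _).toLex_lt h (isCodedOrbit_lower 1) (fun k => ?_)
      (fun k => ?_) hlt).le
    · exact Ioc_subset_Icc_self (betaTLower_iterate_mem h hm k)
    · exact Ioc_subset_Icc_self (betaTLower_iterate_mem h ⟨one_pos, le_rfl⟩ k)

end Expansions

/-! ### Admissible words -/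

/-- A quantity which is bounded above, and which can only be positive if some later value is
larger by a factor at least `β`, is never positive. -/
theorem nonpos_of_le_div_pow {β C : ℝ} (hβ : 1 < β) {u : ℕ → ℝ} (hC : ∀ n, u n ≤ C)
    (hu : ∀ n, u n ≤ 0 ∨ ∃ j, u n ≤ u (n + j + 1) / β ^ (j + 1)) (n : ℕ) : u n ≤ 0 := by
  have h0 : 0 < β := by linarith
  have hC' : ∀ n, u n ≤ max C 0 := fun n => (hC n).trans (le_max_left _ _)
  have hD : 0 ≤ max C 0 := le_max_right _ _
  have key : ∀ m n, u n ≤ max C 0 / β ^ m := by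
    intro m
    induction m with
    | zero => simpa using hC'
    | succ m ih =>
      intro n
      rcases hu n with h | ⟨j, h⟩
      · exact h.trans (by positivity)
      · calc u n ≤ u (n + j + 1) / β ^ (j + 1) := h
          _ ≤ max C 0 / β ^ m / β ^ (j + 1) := by gcongr; exact ih _
          _ ≤ max C 0 / β ^ m / β ^ 1 := by
            gcongr
            · exact hβ.le
            · omega
          _ = max C 0 / β ^ (m + 1) := by rw [div_div, pow_one, pow_succ]
  have hlim : Tendsto (fun m : ℕ => max C 0 / β ^ m) atTop (𝓝 0) :=
    (tendsto_pow_atTop_atTop_of_one_lt hβ).const_div_atTop _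
  exact ge_of_tendsto' hlim fun m => key m n

section Admissible

variable {β α : ℝ} {ω ν : ℕ → Fin 2} {x y : ℕ → ℝ}

/-- The distance of two orbits in terms of the first place where their codings differ. The next
point of the first orbit is compared with `1`, the upper end of the branch with letter `0`. -/
theorem IsCodedOrbit.sub_of_first_diff_zero (h : IsBetaPair β α) (hx : IsCodedOrbit β α ω x)
    (hy : IsCodedOrbit β α ν y) {j : ℕ} (hj : ∀ k < j, ω k = ν k) (h0 : ω j = 0) :
    x 0 - y 0 = (x (j + 1) - 1) / β ^ (j + 1) - (y j - betaCrit β α) / β ^ j := by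
  have h1 := hx.sub_eq hy hj
  have h2 := hx j
  rw [h0] at h2
  norm_num at h2
  rw [h2, pow_succ', show β * x j + α - 1 = β * (x j - betaCrit β α) by linarith [h.mul_crit],
    mul_div_mul_left _ _ h.pos.ne', ← sub_div, eq_div_iff (pow_pos h.pos j).ne']
  linarith

/-- The distance of two orbits in terms of the first place where their codings differ. The next
point of the first orbit is compared with `0`, the lower end of the branch with letter `1`. -/
theorem IsCodedOrbit.sub_of_first_diff_one (h : IsBetaPair β α) (hx : IsCodedOrbit β α ω x)
    (hy : IsCodedOrbit β α ν y) {j : ℕ} (hj : ∀ k < j, ω k = ν k) (h1 : ω j = 1) :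
    x 0 - y 0 = x (j + 1) / β ^ (j + 1) + (betaCrit β α - y j) / β ^ j := by
  have h2 := hx.sub_eq hy hj
  have h3 := hx j
  rw [h1] at h3
  norm_num at h3
  rw [h3, pow_succ', show β * x j + α - 1 = β * (x j - betaCrit β α) by linarith [h.mul_crit],
    mul_div_mul_left _ _ h.pos.ne', ← add_div, eq_div_iff (pow_pos h.pos j).ne']
  linarith

/-- If every shift of `ω` is at most `κ`, and `κ` codes the point `1` with letters `1` only to the
right of the critical point, then all points of the orbit coded by `ω` are at most `1`. -/
theorem betaProj_shift_le_one (h : IsBetaPair β α) {κ : ℕ → Fin 2} (hκ : betaProj β α κ = 1)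
    (hκ1 : ∀ j, κ j = 1 → betaCrit β α ≤ betaProj β α fun k => κ (k + j))
    (hω : ∀ n, toLex (fun k => ω (k + n)) ≤ toLex κ) (n : ℕ) :
    betaProj β α (fun k => ω (k + n)) ≤ 1 := by
  rw [← sub_nonpos]
  refine nonpos_of_le_div_pow h.one_lt (u := fun n => betaProj β α (fun k => ω (k + n)) - 1)
    (C := |α / (1 - β)| + 1 / (β - 1)) (fun n => ?_) (fun n => ?_) n
  · have := (le_abs_self _).trans (abs_betaProj_le (α := α) h.one_lt fun k => ω (k + n))
    linarith
  · rcases (hω n).eq_or_lt with he | hl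
    · have he' : (fun k => ω (k + n)) = κ := he
      left
      simp [he', hκ]
    · obtain ⟨j, hj, h0, h1⟩ := toLex_lt_iff_exists.1 hl
      have hd := ((isCodedOrbit_betaProj h.one_lt ω).shift n).sub_of_first_diff_zero h
        (isCodedOrbit_betaProj h.one_lt κ) hj h0
      have hp : 0 ≤ (betaProj β α (fun k => κ (k + j)) - betaCrit β α) / β ^ j :=
        div_nonneg (sub_nonneg.2 (hκ1 j h1)) (pow_pos h.pos j).le
      right
      refine ⟨j, ?_⟩
      simp only [zero_add, add_zero, hκ] at hd
      rw [hd, show n + j + 1 = j + 1 + n by ring]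
      linarith

/-- If every shift of `ω` is at least `ν`, and `ν` codes the point `0` with letters `0` only to the
left of the critical point, then all points of the orbit coded by `ω` are nonnegative. -/
theorem betaProj_shift_nonneg (h : IsBetaPair β α) (hν : betaProj β α ν = 0)
    (hν0 : ∀ j, ν j = 0 → betaProj β α (fun k => ν (k + j)) ≤ betaCrit β α)
    (hω : ∀ n, toLex ν ≤ toLex fun k => ω (k + n)) (n : ℕ) :
    0 ≤ betaProj β α fun k => ω (k + n) := by
  rw [← neg_nonpos]
  refine nonpos_of_le_div_pow h.one_lt (u := fun n => -betaProj β α (fun k => ω (k + n)))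
    (C := |α / (1 - β)| + 1 / (β - 1)) (fun n => ?_) (fun n => ?_) n
  · exact (neg_le_abs _).trans (abs_betaProj_le (α := α) h.one_lt fun k => ω (k + n))
  · rcases (hω n).eq_or_lt with he | hl
    · have he' : ν = fun k => ω (k + n) := he
      left
      simp [← he', hν]
    · obtain ⟨j, hj, h0, h1⟩ := toLex_lt_iff_exists.1 hl
      have hd := ((isCodedOrbit_betaProj h.one_lt ω).shift n).sub_of_first_diff_one h
        (isCodedOrbit_betaProj h.one_lt ν) (fun k hk => (hj k hk).symm) h1
      have hp : 0 ≤ (betaCrit β α - betaProj β α (fun k => ν (k + j))) / β ^ j :=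
        div_nonneg (sub_nonneg.2 (hν0 j h0)) (pow_pos h.pos j).le
      right
      refine ⟨j, ?_⟩
      simp only [zero_add, add_zero, hν] at hd
      rw [neg_div, show n + j + 1 = j + 1 + n by ring]
      linarith

theorem IsCodedOrbit.betaT_iterate (hx : IsCodedOrbit β α ω x)
    (hmem : ∀ n, x n ∈ Ico (0 : ℝ) 1) (n : ℕ) : (betaT β α)^[n] (x 0) = x n := by
  induction n with
  | zero => rfl
  | succ n ih =>
    have h1 := hx n
    have h2 := hmem (n + 1)
    rw [Function.iterate_succ_apply', ih, betaT, Int.fract_eq_iff]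
    exact ⟨h2.1, h2.2, (ω n : ℕ), by rw [h1]; push_cast; ring⟩

theorem IsCodedOrbit.upperExp_eq (h : IsBetaPair β α) (hx : IsCodedOrbit β α ω x)
    (hmem : ∀ n, x n ∈ Ico (0 : ℝ) 1) : upperExp β α (x 0) = ω := by
  funext n
  have h1 := hx n
  have h2 := hmem (n + 1)
  rcases fin_two_eq (ω n) with h0 | h0
  · rw [h0, upperExp_eq_zero_iff, hx.betaT_iterate hmem, h.lt_crit_iff]
    rw [h0] at h1
    norm_num at h1
    linarith [h2.2]
  · rw [h0, upperExp_eq_one_iff, hx.betaT_iterate hmem]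
    exact hx.crit_le h (fun k => (hmem k).1) h0

theorem IsCodedOrbit.betaTLower_eq (h : IsBetaPair β α) (hx : IsCodedOrbit β α ω x)
    (hmem : ∀ n, x n ∈ Ioc (0 : ℝ) 1) (n : ℕ) :
    (x n ≤ betaCrit β α ↔ ω n = 0) ∧ betaTLower β α (x n) = x (n + 1) := by
  have h1 := hx n
  have h2 := hmem (n + 1)
  rcases fin_two_eq (ω n) with h0 | h0
  · have hle := hx.le_crit h (fun k => (hmem k).2) h0
    refine ⟨by simp [hle, h0], ?_⟩
    rw [betaTLower, if_pos hle, h1, h0]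
    simp
  · have hlt : ¬ x n ≤ betaCrit β α := by
      rw [h.le_crit_iff]
      rw [h0] at h1
      norm_num at h1
      linarith [h2.1]
    refine ⟨by simp [hlt, h0], ?_⟩
    rw [betaTLower, if_neg hlt, h1, h0]
    simp

theorem IsCodedOrbit.lowerExp_eq (h : IsBetaPair β α) (hx : IsCodedOrbit β α ω x)
    (hmem : ∀ n, x n ∈ Ioc (0 : ℝ) 1) : lowerExp β α (x 0) = ω := by
  have hit : ∀ n, (betaTLower β α)^[n] (x 0) = x n := by
    intro n
    induction n with
    | zero => rfl
    | succ n ih => rw [Function.iterate_succ_apply', ih, (hx.betaTLower_eq h hmem n).2]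
  funext n
  rw [lowerExp, hit]
  rcases fin_two_eq (ω n) with h0 | h0
  · rw [if_pos ((hx.betaTLower_eq h hmem n).1.2 h0), h0]
  · rw [if_neg (by simp [(hx.betaTLower_eq h hmem n).1, h0]), h0]

theorem betaProj_lowerExp_shift (h : IsBetaPair β α) (n : ℕ) :
    (betaProj β α fun k => lowerExp β α 1 (k + n)) = (betaTLower β α)^[n] 1 := by
  rw [← lowerExp_shift, betaProj_lowerExp h]
  exact betaTLower_iterate_mem h ⟨one_pos, le_rfl⟩ n

theorem betaProj_upperExp_shift (h : IsBetaPair β α) {a : ℝ} (ha : a ∈ Ico (0 : ℝ) 1) (n : ℕ) :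
    (betaProj β α fun k => upperExp β α a (k + n)) = (betaT β α)^[n] a := by
  rw [← upperExp_shift, betaProj_upperExp h]
  exact betaT_iterate_mem ha n

/-- A word all of whose shifts lie between `τ⁺(0)` and (strictly below) `τ⁻(1)` is the upper
expansion of a point. -/
theorem exists_upperExp_eq (h : IsBetaPair β α)
    (hlow : ∀ n, toLex (upperExp β α 0) ≤ toLex fun k => ω (k + n))
    (hup : ∀ n, toLex (fun k => ω (k + n)) < toLex (lowerExp β α 1)) :
    ∃ a ∈ Ico (0 : ℝ) 1, upperExp β α a = ω := by
  have h0 : (0 : ℝ) ∈ Ico (0 : ℝ) 1 := ⟨le_rfl, one_pos⟩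
  have horb := isCodedOrbit_betaProj (α := α) h.one_lt ω
  have hnonneg := betaProj_shift_nonneg h (betaProj_upperExp h h0) (fun j hj => by
    rw [betaProj_upperExp_shift h h0]
    exact (upperExp_eq_zero_iff.1 hj).le) hlow
  have hone : betaProj β α (lowerExp β α 1) = 1 := betaProj_lowerExp h ⟨one_pos, le_rfl⟩
  have hle := betaProj_shift_le_one h hone (fun j hj => by
    rw [betaProj_lowerExp_shift h]
    exact (lowerExp_eq_one_iff.1 hj).le) fun n => (hup n).le
  have hlt : ∀ n, betaProj β α (fun k => ω (k + n)) < 1 := by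
    intro n
    obtain ⟨j, hj, hj0, hj1⟩ := toLex_lt_iff_exists.1 (hup n)
    have hd := (horb.shift n).sub_of_first_diff_zero h (isCodedOrbit_lower 1) hj hj0
    have hd1 : 0 < ((betaTLower β α)^[j] 1 - betaCrit β α) / β ^ j :=
      div_pos (sub_pos.2 (lowerExp_eq_one_iff.1 hj1)) (pow_pos h.pos j)
    have hd2 : (betaProj β α (fun k => ω (k + (j + 1 + n))) - 1) / β ^ (j + 1) ≤ 0 :=
      div_nonpos_of_nonpos_of_nonneg (sub_nonpos.2 (hle _)) (pow_pos h.pos _).le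
    simp only [zero_add, Function.iterate_zero, id_eq] at hd
    linarith
  refine ⟨_, ⟨hnonneg 0, hlt 0⟩, horb.upperExp_eq h fun n => ⟨hnonneg n, hlt n⟩⟩

end Admissible

/-! ### The greedy base -/

section GreedyBase

variable {β α : ℝ}

theorem betaProj_zero (b : ℝ) (ω : ℕ → Fin 2) :
    betaProj b 0 ω = ∑' k, ((ω k : ℕ) : ℝ) / b ^ (k + 1) := by
  simp [betaProj]

theorem lowerExp_one_zero (h : IsBetaPair β α) : lowerExp β α 1 0 = 1 := by
  rw [lowerExp_eq_one_iff]
  exact h.crit_lt_one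

/-- The lower expansion of `1` does not end in zeros, as the fixed point `α / (1 - β)` of the
branch with letter `0` is not positive. -/
theorem exists_lowerExp_one_eq_one (h : IsBetaPair β α) (n : ℕ) :
    ∃ k, lowerExp β α 1 (k + n) = 1 := by
  by_contra! hne
  have hz : (fun k => lowerExp β α 1 (k + n)) = fun _ => 0 :=
    funext fun k => (fin_two_eq _).resolve_right (hne k)
  have h1 := betaProj_lowerExp_shift h n
  have h2 := betaTLower_iterate_mem h (x := 1) ⟨one_pos, le_rfl⟩ n
  have h3 : α / (1 - β) ≤ 0 :=
    div_nonpos_of_nonneg_of_nonpos h.nonneg (by linarith [h.one_lt])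
  rw [hz, betaProj] at h1
  simp at h1
  linarith [h2.1]

theorem betaProj_zero_pos {b : ℝ} (hb : 1 < b) {ω : ℕ → Fin 2} {k : ℕ} (hk : ω k = 1) :
    0 < betaProj b 0 ω := by
  have h0 : 0 < b := by linarith
  rw [betaProj_zero]
  exact (summable_letter_div hb ω).tsum_pos (fun i => by positivity) k
    (by rw [hk]; simp only [Fin.val_one, Nat.cast_one]; positivity)

theorem betaProj_zero_lt {b c : ℝ} (hb : 1 < b) (hbc : b < c) {ω : ℕ → Fin 2} {k : ℕ}
    (hk : ω k = 1) : betaProj c 0 ω < betaProj b 0 ω := by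
  have h0 : 0 < b := by linarith
  rw [betaProj_zero, betaProj_zero]
  refine Summable.tsum_lt_tsum (i := k) (fun i => ?_) ?_ (summable_letter_div (hb.trans hbc) ω)
    (summable_letter_div hb ω)
  · simp only
    gcongr
  · rw [hk]
    simp only [Fin.val_one, Nat.cast_one]
    gcongr

theorem continuousOn_betaProj_zero {b : ℝ} (hb : 1 < b) (ω : ℕ → Fin 2) :
    ContinuousOn (fun c => betaProj c 0 ω) (Ici b) := by
  have h0 : 0 < b := by linarith
  simp only [betaProj_zero]
  refine continuousOn_tsum (u := fun k => b⁻¹ * b⁻¹ ^ k) (fun k => ?_)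
    (hasSum_inv_pow_succ hb).summable fun k c hc => ?_
  · refine continuousOn_const.div (by fun_prop) fun c hc => ?_
    exact pow_ne_zero _ (h0.trans_le hc).ne'
  · have hc' : b ≤ c := hc
    have hc0 : 0 < c := h0.trans_le hc'
    refine (norm_letter_div_le (hb.trans_le hc') ω k).trans ?_
    gcongr

/-- A base in which `τ⁻_{β,α}(1)` is an expansion of `1` is a greedy base: lexicographic maximality
of the word among its shifts keeps the orbit it codes below `1`. -/
theorem isGreedyBase_iff (h : IsBetaPair β α) {b : ℝ} :
    IsGreedyBase β α b ↔ 1 < b ∧ b ≤ 2 ∧ betaProj b 0 (lowerExp β α 1) = 1 := by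
  refine and_congr_right fun hb => and_congr_right fun hb2 => ⟨fun he => ?_, fun he => ?_⟩
  · rw [he]
    exact betaProj_lowerExp (isBetaPair_zero hb hb2) ⟨one_pos, le_rfl⟩
  · have hp := isBetaPair_zero hb hb2
    have horb := isCodedOrbit_betaProj (α := 0) hb (lowerExp β α 1)
    have hpos : ∀ n, 0 < betaProj b 0 fun k => lowerExp β α 1 (k + n) := fun n =>
      (exists_lowerExp_one_eq_one h n).elim fun k hk => betaProj_zero_pos hb (k := k) hk
    have hle := betaProj_shift_le_one hp he
      (fun j hj => horb.crit_le hp (fun n => (hpos n).le) hj) (toLex_lowerExp_shift_le h)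
    have := horb.lowerExp_eq hp fun n => ⟨hpos n, hle n⟩
    simp only [add_zero] at this
    rw [he] at this
    exact this.symm

theorem existsUnique_isGreedyBase (h : IsBetaPair β α) : ∃! b, IsGreedyBase β α b := by
  simp only [isGreedyBase_iff h]
  have h1 := h.one_lt
  have hβ : 1 ≤ betaProj β 0 (lowerExp β α 1) := by
    have hs := betaProj_lowerExp h (x := 1) ⟨one_pos, le_rfl⟩
    have h3 : α / (1 - β) ≤ 0 :=
      div_nonpos_of_nonneg_of_nonpos h.nonneg (by linarith)
    rw [betaProj_zero]
    rw [betaProj] at hs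
    linarith
  have h2 : betaProj 2 0 (lowerExp β α 1) ≤ 1 := by
    rw [betaProj_zero]
    have := (tsum_letter_div_mem one_lt_two (lowerExp β α 1)).2
    norm_num at this ⊢
    exact this
  obtain ⟨b, ⟨hb1, hb2⟩, hb⟩ := intermediate_value_Icc' h.le_two
    ((continuousOn_betaProj_zero h1 (lowerExp β α 1)).mono Icc_subset_Ici_self) ⟨h2, hβ⟩
  refine ⟨b, ⟨h1.trans_le hb1, hb2, hb⟩, fun c ⟨hc1, hc2, hc⟩ => ?_⟩
  have hb : betaProj b 0 (lowerExp β α 1) = 1 := hb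
  rcases lt_trichotomy c b with hlt | he | hlt
  · have := betaProj_zero_lt hc1 hlt (lowerExp_one_zero h)
    linarith
  · exact he
  · have := betaProj_zero_lt (h1.trans_le hb1) hlt (lowerExp_one_zero h)
    linarith

theorem lowerExp_one_eq_const_iff (h : IsBetaPair β α) :
    (lowerExp β α 1 = fun _ => 1) ↔ α = 2 - β := by
  constructor
  · intro hc
    have hs := betaProj_lowerExp h (x := 1) ⟨one_pos, le_rfl⟩
    have h1 : β - 1 ≠ 0 := by linarith [h.one_lt]
    have h2 : ∑' k : ℕ, (((1 : Fin 2) : ℕ) : ℝ) / β ^ (k + 1) = 1 / (β - 1) := by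
      rw [← (hasSum_inv_pow_succ h.one_lt).tsum_eq]
      refine tsum_congr fun k => ?_
      simp [pow_succ']
      ring
    rw [hc, betaProj, h2, ← neg_sub β 1, div_neg] at hs
    field_simp at hs
    linarith
  · intro hα
    have hc := h.crit_lt_one
    have hfix : betaTLower β α 1 = 1 := by
      rw [betaTLower, if_neg (not_le.2 hc), hα]
      ring
    funext n
    rw [lowerExp_eq_one_iff, Function.iterate_fixed hfix]
    exact hc

theorem IsGreedyBase.isBetaPair {b : ℝ} (hb : IsGreedyBase β α b) : IsBetaPair b 0 :=
  isBetaPair_zero hb.1 hb.2.1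

theorem IsGreedyBase.lt_two_iff (h : IsBetaPair β α) {b : ℝ} (hb : IsGreedyBase β α b) :
    b < 2 ↔ α < 2 - β := by
  have h1 := lowerExp_one_eq_const_iff h
  have h2 := lowerExp_one_eq_const_iff hb.isBetaPair
  rw [hb.2.2, h2] at h1
  rw [hb.2.1.lt_iff_ne, h.le.lt_iff_ne, not_iff_not, ← h1]
  constructor <;> intro <;> linarith

end GreedyBase

/-! ### The map `π_{β'} ∘ τ⁺_{β,α}` -/

section GreedyMap

variable {β α b : ℝ}

theorem zero_mem_Ico : (0 : ℝ) ∈ Ico (0 : ℝ) 1 := ⟨le_rfl, one_pos⟩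

theorem upperExp_zero_zero (hb : IsBetaPair b 0) : upperExp b 0 0 = fun _ => 0 := by
  have hfix : betaT b 0 0 = 0 := by simp [betaT]
  funext n
  rw [upperExp_eq_zero_iff, Function.iterate_fixed hfix]
  exact hb.crit_pos

/-- The point `greedyMap β α b x` exists in `[0, 1)` with the same expansion in base `b` as `x`,
because every upper expansion for `(β, α)` is admissible for `(b, 0)`. -/
theorem greedyMap_spec (h : IsBetaPair β α) (hb : IsGreedyBase β α b) {x : ℝ}
    (hx : x ∈ Ico (0 : ℝ) 1) :
    greedyMap β α b x ∈ Ico (0 : ℝ) 1 ∧ upperExp b 0 (greedyMap β α b x) = upperExp β α x := by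
  obtain ⟨a, ha, he⟩ := exists_upperExp_eq hb.isBetaPair (ω := upperExp β α x)
    (fun n => by
      rw [upperExp_zero_zero hb.isBetaPair]
      exact Pi.toLex_monotone fun k => Fin.zero_le _)
    (fun n => by
      rw [← upperExp_shift, ← hb.2.2]
      exact toLex_upperExp_lt_lowerExp_one h (betaT_iterate_mem hx n))
  have hg : greedyMap β α b x = a := by
    rw [greedyMap, ← he, betaProj_upperExp hb.isBetaPair ha]
  rw [hg]
  exact ⟨ha, he⟩

theorem greedyMap_mem (h : IsBetaPair β α) (hb : IsGreedyBase β α b) {x : ℝ}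
    (hx : x ∈ Ico (0 : ℝ) 1) : greedyMap β α b x ∈ Ico (0 : ℝ) 1 :=
  (greedyMap_spec h hb hx).1

theorem upperExp_greedyMap (h : IsBetaPair β α) (hb : IsGreedyBase β α b) {x : ℝ}
    (hx : x ∈ Ico (0 : ℝ) 1) : upperExp b 0 (greedyMap β α b x) = upperExp β α x :=
  (greedyMap_spec h hb hx).2

theorem greedyMap_lt_iff (h : IsBetaPair β α) (hb : IsGreedyBase β α b) {x y : ℝ}
    (hx : x ∈ Ico (0 : ℝ) 1) (hy : y ∈ Ico (0 : ℝ) 1) :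
    greedyMap β α b x < greedyMap β α b y ↔ x < y := by
  rw [← toLex_upperExp_lt_iff h hx hy, ← upperExp_greedyMap h hb hx, ← upperExp_greedyMap h hb hy,
    toLex_upperExp_lt_iff hb.isBetaPair (greedyMap_mem h hb hx) (greedyMap_mem h hb hy)]

theorem greedyMap_le_iff (h : IsBetaPair β α) (hb : IsGreedyBase β α b) {x y : ℝ}
    (hx : x ∈ Ico (0 : ℝ) 1) (hy : y ∈ Ico (0 : ℝ) 1) :
    greedyMap β α b x ≤ greedyMap β α b y ↔ x ≤ y := by
  rw [← not_lt, greedyMap_lt_iff h hb hy hx, not_lt]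

theorem betaT_iterate_greedyMap (h : IsBetaPair β α) (hb : IsGreedyBase β α b) {x : ℝ}
    (hx : x ∈ Ico (0 : ℝ) 1) (n : ℕ) :
    (betaT b 0)^[n] (greedyMap β α b x) = greedyMap β α b ((betaT β α)^[n] x) := by
  have hs : upperExp β α ((betaT β α)^[n] x) =
      upperExp b 0 ((betaT b 0)^[n] (greedyMap β α b x)) := by
    rw [upperExp_shift, upperExp_shift, upperExp_greedyMap h hb hx]
  rw [greedyMap, greedyMap, hs]
  exact (betaProj_upperExp hb.isBetaPair
    (betaT_iterate_mem (greedyMap_mem h hb hx) n)).symm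

theorem mem_survivorSet {t x : ℝ} : x ∈ survivorSet β α t ↔
    x ∈ Ico (0 : ℝ) 1 ∧ ∀ n, t ≤ (betaT β α)^[n] x := by
  refine and_congr_right fun hx => forall_congr' fun n => ?_
  have := (betaT_iterate_mem (β := β) (α := α) hx n).1
  simp [this]

theorem mem_bifurcationSet {x : ℝ} : x ∈ bifurcationSet β α ↔
    x ∈ Ico (0 : ℝ) 1 ∧ ∀ n, x ≤ (betaT β α)^[n] x := mem_survivorSet (t := x)

theorem exists_greedyMap_eq (h : IsBetaPair β α) (hb : IsGreedyBase β α b) {y : ℝ}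
    (hy : y ∈ survivorSet b 0 (greedyMap β α b 0)) :
    ∃ x ∈ Ico (0 : ℝ) 1, greedyMap β α b x = y := by
  obtain ⟨hy0, hy⟩ := mem_survivorSet.1 hy
  have hp := hb.isBetaPair
  obtain ⟨x, hx, he⟩ := exists_upperExp_eq h (ω := upperExp b 0 y)
    (fun n => by
      rw [← upperExp_shift, ← upperExp_greedyMap h hb zero_mem_Ico]
      exact (toLex_upperExp_le_iff hp (greedyMap_mem h hb zero_mem_Ico)
        (betaT_iterate_mem hy0 n)).2 (hy n))
    (fun n => by
      rw [← upperExp_shift, hb.2.2]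
      exact toLex_upperExp_lt_lowerExp_one hp (betaT_iterate_mem hy0 n))
  exact ⟨x, hx, by rw [greedyMap, he, betaProj_upperExp hp hy0]⟩

theorem survivorSet_anti {s t : ℝ} (hst : s ≤ t) : survivorSet b 0 t ⊆ survivorSet b 0 s :=
  fun _ hx => mem_survivorSet.2
    ⟨(mem_survivorSet.1 hx).1, fun n => hst.trans ((mem_survivorSet.1 hx).2 n)⟩

theorem greedyMap_mem_survivorSet_iff (h : IsBetaPair β α) (hb : IsGreedyBase β α b) {x t : ℝ}
    (hx : x ∈ Ico (0 : ℝ) 1) (ht : t ∈ Ico (0 : ℝ) 1) :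
    greedyMap β α b x ∈ survivorSet b 0 (greedyMap β α b t) ↔ x ∈ survivorSet β α t := by
  simp only [mem_survivorSet, greedyMap_mem h hb hx, hx, true_and]
  refine forall_congr' fun n => ?_
  rw [betaT_iterate_greedyMap h hb hx, greedyMap_le_iff h hb ht (betaT_iterate_mem hx n)]

theorem greedyMap_image_survivorSet (h : IsBetaPair β α) (hb : IsGreedyBase β α b) {t : ℝ}
    (ht : t ∈ Ico (0 : ℝ) 1) :
    greedyMap β α b '' survivorSet β α t = survivorSet b 0 (greedyMap β α b t) := by
  ext y
  constructor
  · rintro ⟨x, hx, rfl⟩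
    exact (greedyMap_mem_survivorSet_iff h hb hx.1 ht).2 hx
  · intro hy
    obtain ⟨x, hx, rfl⟩ := exists_greedyMap_eq h hb
      (survivorSet_anti ((greedyMap_le_iff h hb zero_mem_Ico ht).2 ht.1) hy)
    exact ⟨x, (greedyMap_mem_survivorSet_iff h hb hx ht).1 hy, rfl⟩

theorem survivorSet_zero : survivorSet β α 0 = Ico (0 : ℝ) 1 := by
  ext x
  rw [mem_survivorSet, and_iff_left_iff_imp]
  exact fun hx n => (betaT_iterate_mem hx n).1

theorem greedyMap_mem_bifurcationSet_iff (h : IsBetaPair β α) (hb : IsGreedyBase β α b) {x : ℝ}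
    (hx : x ∈ Ico (0 : ℝ) 1) :
    greedyMap β α b x ∈ bifurcationSet b 0 ↔ x ∈ bifurcationSet β α :=
  greedyMap_mem_survivorSet_iff h hb hx hx

theorem greedyMap_image_bifurcationSet (h : IsBetaPair β α) (hb : IsGreedyBase β α b) :
    greedyMap β α b '' bifurcationSet β α =
      bifurcationSet b 0 ∩ Icc (greedyMap β α b 0) 1 := by
  ext y
  constructor
  · rintro ⟨x, hx, rfl⟩
    exact ⟨(greedyMap_mem_bifurcationSet_iff h hb hx.1).2 hx,
      (greedyMap_le_iff h hb zero_mem_Ico hx.1).2 hx.1.1, (greedyMap_mem h hb hx.1).2.le⟩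
  · rintro ⟨hy, hy0, -⟩
    obtain ⟨x, hx, rfl⟩ := exists_greedyMap_eq h hb (survivorSet_anti hy0 hy)
    exact ⟨x, (greedyMap_mem_bifurcationSet_iff h hb hx).1 hy, rfl⟩

end GreedyMap

/-! ### Hausdorff dimension of survivor sets -/

section Dimension

variable {β α : ℝ}

theorem sub_le_inv_pow (h : IsBetaPair β α) {x y : ℝ} (hx : x ∈ Ico (0 : ℝ) 1)
    (hy : y ∈ Ico (0 : ℝ) 1) {j : ℕ} (hj : ∀ k < j, upperExp β α x k = upperExp β α y k) :
    |x - y| ≤ (β ^ j)⁻¹ := by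
  have hd := (isCodedOrbit_upper h hx).sub_eq (isCodedOrbit_upper h hy) hj
  have hp := pow_pos h.pos j
  have h1 := betaT_iterate_mem (β := β) (α := α) hx j
  have h2 := betaT_iterate_mem (β := β) (α := α) hy j
  have h3 : |(betaT β α)^[j] x - (betaT β α)^[j] y| ≤ 1 :=
    abs_le.2 ⟨by linarith [h1.1, h2.2], by linarith [h1.2, h2.1]⟩
  rw [hd, abs_mul, abs_of_pos hp] at h3
  rw [← one_div, le_div_iff₀' hp]
  exact h3

/-- Two points of the survivor set whose expansions first differ at the place `j` are separated by
the preimage of the hole `[0, t)` adjacent to a preimage of the critical point. -/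
theorem inv_pow_le_sub (h : IsBetaPair β α) {x y t : ℝ} (hx : x ∈ Ico (0 : ℝ) 1)
    (hy : y ∈ survivorSet β α t) {j : ℕ} (hj : ∀ k < j, upperExp β α x k = upperExp β α y k)
    (h0 : upperExp β α x j = 0) (h1 : upperExp β α y j = 1) :
    t / β * (β ^ j)⁻¹ ≤ y - x := by
  obtain ⟨hy0, hy⟩ := mem_survivorSet.1 hy
  have hd := (isCodedOrbit_upper h hy0).sub_of_first_diff_one h (isCodedOrbit_upper h hx)
    (fun k hk => (hj k hk).symm) h1
  have hp := pow_pos h.pos (j + 1)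
  have h2 : 0 ≤ (betaCrit β α - (betaT β α)^[j] x) / β ^ j :=
    div_nonneg (sub_nonneg.2 (upperExp_eq_zero_iff.1 h0).le) (pow_pos h.pos j).le
  have h3 : t / β ^ (j + 1) ≤ (betaT β α)^[j + 1] y / β ^ (j + 1) :=
    div_le_div_of_nonneg_right (hy (j + 1)) hp.le
  have h4 : t / β * (β ^ j)⁻¹ = t / β ^ (j + 1) := by
    rw [pow_succ', ← div_div, div_eq_mul_inv (t / β)]
  simp only [Function.iterate_zero, id_eq] at hd
  linarith

/-- A map between two systems which preserves the codings is Hölder on survivor sets with the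
ratio of the logarithms of the slopes as its exponent: both metrics are comparable to the slope
raised to minus the length of the common prefix. -/
theorem dimH_image_le_of_upperExp_eq {β₁ α₁ β₂ α₂ t : ℝ} (h₁ : IsBetaPair β₁ α₁)
    (h₂ : IsBetaPair β₂ α₂) (ht : 0 < t) {f : ℝ → ℝ}
    (hf : ∀ x ∈ survivorSet β₁ α₁ t, f x ∈ Ico (0 : ℝ) 1 ∧
      upperExp β₂ α₂ (f x) = upperExp β₁ α₁ x) :
    dimH (f '' survivorSet β₁ α₁ t) ≤
      dimH (survivorSet β₁ α₁ t) / ENNReal.ofReal (Real.log β₂ / Real.log β₁) := by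
  set s := Real.log β₂ / Real.log β₁ with hs
  have hl1 := Real.log_pos h₁.one_lt
  have hspos : 0 < s := div_pos (Real.log_pos h₂.one_lt) hl1
  have hpow : ∀ j : ℕ, (((β₁ ^ j)⁻¹ : ℝ)) ^ s = (β₂ ^ j)⁻¹ := by
    intro j
    have hb : β₁ ^ s = β₂ := by
      rw [Real.rpow_def_of_pos h₁.pos, hs, mul_div_cancel₀ _ hl1.ne', Real.exp_log h₂.pos]
    rw [Real.inv_rpow (pow_pos h₁.pos j).le, ← Real.rpow_natCast, ← Real.rpow_mul h₁.pos.le,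
      mul_comm, Real.rpow_mul h₁.pos.le, hb, Real.rpow_natCast]
  have hc : 0 < β₁ / t := div_pos h₁.pos ht
  have key : ∀ x ∈ survivorSet β₁ α₁ t, ∀ y ∈ survivorSet β₁ α₁ t, x < y →
      |f x - f y| ≤ (β₁ / t) ^ s * |x - y| ^ s := by
    intro x hx y hy hlt
    obtain ⟨j, hj, h0, h1⟩ := toLex_lt_iff_exists.1 ((toLex_upperExp_lt_iff h₁ hx.1 hy.1).2 hlt)
    have hlow := inv_pow_le_sub h₁ hx.1 hy hj h0 h1
    have hup := sub_le_inv_pow h₂ (hf x hx).1 (hf y hy).1 (j := j) fun k hk => by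
      rw [(hf x hx).2, (hf y hy).2, hj k hk]
    refine hup.trans ?_
    rw [← hpow, ← Real.mul_rpow hc.le (abs_nonneg _)]
    refine Real.rpow_le_rpow (inv_nonneg.2 (pow_pos h₁.pos j).le) ?_ hspos.le
    rw [abs_sub_comm, abs_of_pos (sub_pos.2 hlt)]
    calc (β₁ ^ j)⁻¹ = β₁ / t * (t / β₁ * (β₁ ^ j)⁻¹) := by
          rw [← mul_assoc, div_mul_div_cancel₀ ht.ne', div_self h₁.pos.ne', one_mul]
      _ ≤ β₁ / t * (y - x) := by gcongr
  have hH : HolderOnWith ((β₁ / t) ^ s).toNNReal s.toNNReal f (survivorSet β₁ α₁ t) := by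
    intro x hx y hy
    rw [edist_dist, edist_dist, Real.coe_toNNReal _ hspos.le,
      ENNReal.ofReal_rpow_of_nonneg dist_nonneg hspos.le]
    change _ ≤ ENNReal.ofReal _ * _
    rw [← ENNReal.ofReal_mul (Real.rpow_nonneg hc.le _)]
    refine ENNReal.ofReal_le_ofReal ?_
    rw [Real.dist_eq, Real.dist_eq]
    rcases lt_trichotomy x y with hlt | rfl | hlt
    · exact key x hx y hy hlt
    · rw [sub_self, abs_zero]
      positivity
    · rw [abs_sub_comm, abs_sub_comm x]
      exact key y hy x hx hlt
  exact hH.dimH_image_le (Real.toNNReal_pos.2 hspos)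

theorem dimH_survivorSet_eq (h : IsBetaPair β α) {b : ℝ} (hb : IsGreedyBase β α b) {t : ℝ}
    (ht : t ∈ Ioo (0 : ℝ) 1) :
    dimH (survivorSet β α t) = ENNReal.ofReal (Real.log b / Real.log β) *
      dimH (survivorSet b 0 (greedyMap β α b t)) := by
  have ht' : t ∈ Ico (0 : ℝ) 1 := Ioo_subset_Ico_self ht
  have hp := hb.isBetaPair
  have hl1 := Real.log_pos h.one_lt
  have hl2 := Real.log_pos hp.one_lt
  have himage := greedyMap_image_survivorSet h hb ht'
  have htpos : 0 < greedyMap β α b t :=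
    (greedyMap_mem h hb zero_mem_Ico).1.trans_lt ((greedyMap_lt_iff h hb zero_mem_Ico ht').2 ht.1)
  have hinv : ∀ x ∈ Ico (0 : ℝ) 1, betaProj β α (upperExp b 0 (greedyMap β α b x)) = x :=
    fun x hx => by rw [upperExp_greedyMap h hb hx, betaProj_upperExp h hx]
  have h1 := dimH_image_le_of_upperExp_eq h hp ht.1 (f := greedyMap β α b)
    fun x hx => greedyMap_spec h hb hx.1
  have h2 := dimH_image_le_of_upperExp_eq hp h htpos
    (f := fun y => betaProj β α (upperExp b 0 y)) fun y hy => by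
      rw [← himage] at hy
      obtain ⟨x, hx, rfl⟩ := hy
      rw [hinv x hx.1, upperExp_greedyMap h hb hx.1]
      exact ⟨hx.1, rfl⟩
  have himage' : (fun y => betaProj β α (upperExp b 0 y)) ''
      survivorSet b 0 (greedyMap β α b t) = survivorSet β α t := by
    rw [← himage, image_image, image_congr fun x hx => hinv x hx.1, image_id']
  rw [himage] at h1
  rw [himage'] at h2
  have hs : ENNReal.ofReal (Real.log b / Real.log β) ≠ 0 :=
    (ENNReal.ofReal_pos.2 (div_pos hl2 hl1)).ne'
  apply le_antisymm
  · rwa [← inv_div, ENNReal.ofReal_inv_of_pos (div_pos hl2 hl1), div_eq_mul_inv, inv_inv,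
      mul_comm] at h2
  · rwa [ENNReal.le_div_iff_mul_le (Or.inl hs) (Or.inl ENNReal.ofReal_ne_top), mul_comm] at h1

end Dimension

/-! ### Continuity of the coding on the bifurcation set -/

section Continuity

variable {β α : ℝ}

theorem betaT_tendsto_right (h : IsBetaPair β α) {x : ℝ} (hx : x ∈ Ico (0 : ℝ) 1) :
    Tendsto (betaT β α) (𝓝[≥] x) (𝓝[≥] betaT β α x) := by
  have key : ∀ c : ℝ, Tendsto (fun y => β * y + α - c) (𝓝[≥] x) (𝓝[≥] (β * x + α - c)) := by
    intro c
    refine tendsto_nhdsWithin_iff.2 ⟨?_, ?_⟩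
    · have : Continuous fun y : ℝ => β * y + α - c := by fun_prop
      exact (this.tendsto x).mono_left nhdsWithin_le_nhds
    · filter_upwards [self_mem_nhdsWithin] with y hy
      have := mul_le_mul_of_nonneg_left (show x ≤ y from hy) h.pos.le
      simp only [mem_Ici]
      linarith
  rcases lt_or_ge x (betaCrit β α) with hc | hc
  · rw [betaT_of_lt h hx.1 hc]
    have := key 0
    simp only [sub_zero] at this
    refine this.congr' ?_
    filter_upwards [self_mem_nhdsWithin, mem_nhdsWithin_of_mem_nhds (gt_mem_nhds hc)] with y hy hyc
    exact (betaT_of_lt h (hx.1.trans hy) hyc).symm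
  · rw [betaT_of_ge h hc hx.2]
    refine (key 1).congr' ?_
    filter_upwards [self_mem_nhdsWithin, mem_nhdsWithin_of_mem_nhds (gt_mem_nhds hx.2)]
      with y hy hy1
    exact (betaT_of_ge h (hc.trans hy) hy1).symm

theorem upperExp_tendsto_right (h : IsBetaPair β α) {x : ℝ} (hx : x ∈ Ico (0 : ℝ) 1) :
    Tendsto (upperExp β α) (𝓝[≥] x) (𝓝 (upperExp β α x)) := by
  have hlim : ∀ n : ℕ, Tendsto ((betaT β α)^[n]) (𝓝[≥] x) (𝓝[≥] ((betaT β α)^[n] x)) := by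
    intro n
    induction n with
    | zero => exact tendsto_id
    | succ k ih =>
      rw [Function.iterate_succ', Function.comp_apply]
      exact (betaT_tendsto_right h (betaT_iterate_mem hx k)).comp ih
  refine tendsto_pi_nhds.2 fun n => tendsto_nhds_of_eventually_eq ?_
  rcases fin_two_eq (upperExp β α x n) with h0 | h0
  · rw [h0]
    simp only [upperExp_eq_zero_iff] at h0 ⊢
    exact (hlim n).eventually (mem_nhdsWithin_of_mem_nhds (gt_mem_nhds h0))
  · rw [h0]
    simp only [upperExp_eq_one_iff] at h0 ⊢
    filter_upwards [(hlim n).eventually self_mem_nhdsWithin] with y hy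
    exact h0.trans hy

theorem lowerExp_eq_upperExp (h : IsBetaPair β α) {x : ℝ} (hx : x ∈ Ico (0 : ℝ) 1)
    (hc : ∀ n, (betaT β α)^[n] x ≠ betaCrit β α) : lowerExp β α x = upperExp β α x := by
  have hit : ∀ n, (betaTLower β α)^[n] x = (betaT β α)^[n] x := by
    intro n
    induction n with
    | zero => rfl
    | succ n ih =>
      have hm := betaT_iterate_mem (β := β) (α := α) hx n
      rw [Function.iterate_succ_apply', Function.iterate_succ_apply', ih, betaTLower]
      split_ifs with hle
      · rw [betaT_of_lt h hm.1 (lt_of_le_of_ne hle (hc n))]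
      · rw [betaT_of_ge h (not_le.1 hle).le hm.2]
  funext n
  rcases fin_two_eq (upperExp β α x n) with h0 | h0
  · rw [h0, lowerExp, hit, if_pos (upperExp_eq_zero_iff.1 h0).le]
  · rw [h0, lowerExp_eq_one_iff, hit]
    exact lt_of_le_of_ne (upperExp_eq_one_iff.1 h0) (hc n).symm

theorem betaT_crit (h : IsBetaPair β α) : betaT β α (betaCrit β α) = 0 := by
  rw [betaT, h.mul_crit, Int.fract_one]

/-- A positive point of the bifurcation set never reaches the critical point, since the next
point of its orbit would be `0`. -/
theorem continuousAt_upperExp (h : IsBetaPair β α) {x : ℝ} (hx : x ∈ bifurcationSet β α)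
    (h0 : 0 < x) : ContinuousAt (upperExp β α) x := by
  obtain ⟨hx1, hx⟩ := mem_bifurcationSet.1 hx
  have hc : ∀ n, (betaT β α)^[n] x ≠ betaCrit β α := by
    intro n hn
    have := hx (n + 1)
    rw [Function.iterate_succ_apply', hn, betaT_crit h] at this
    linarith
  rw [ContinuousAt, ← nhdsLT_sup_nhdsGE, tendsto_sup]
  refine ⟨?_, upperExp_tendsto_right h hx1⟩
  rw [← lowerExp_eq_upperExp h hx1 hc]
  exact upperExp_tendsto h.one_lt h.nonneg h.le ⟨h0, hx1.2.le⟩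

theorem continuousWithinAt_upperExp (h : IsBetaPair β α) {x : ℝ} (hx : x ∈ bifurcationSet β α) :
    ContinuousWithinAt (upperExp β α) (bifurcationSet β α) x := by
  rcases hx.1.1.eq_or_lt with h0 | h0
  · refine (upperExp_tendsto_right h hx.1).mono_left (nhdsWithin_mono _ fun y hy => ?_)
    rw [← h0]
    exact hy.1.1
  · exact (continuousAt_upperExp h hx h0).continuousWithinAt

theorem continuous_betaProj (hβ : 1 < β) : Continuous (betaProj β α) := by
  refine continuous_const.add (continuous_tsum (u := fun k => β⁻¹ * β⁻¹ ^ k) (fun k => ?_)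
    (hasSum_inv_pow_succ hβ).summable fun k ω => norm_letter_div_le hβ ω k)
  have : Continuous fun a : Fin 2 => ((a : ℕ) : ℝ) / β ^ (k + 1) := continuous_of_discreteTopology
  exact this.comp (continuous_apply k)

theorem IsIsolatedIn.of_image {f : ℝ → ℝ} {S S' : Set ℝ} {x : ℝ} (hx : x ∈ S)
    (hf : ContinuousWithinAt f S x) (hinj : InjOn f S) (hmaps : MapsTo f S S')
    (hiso : IsIsolatedIn (f x) S') : IsIsolatedIn x S := by
  obtain ⟨-, ε, hε, h⟩ := hiso
  obtain ⟨δ, hδ, h'⟩ := Metric.continuousWithinAt_iff.1 hf ε hε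
  exact ⟨hx, δ, hδ, fun y hy hyx => hinj hy hx (h _ (hmaps hy) (h' hy hyx))⟩

end Continuity

/-! ### Bifurcation points near zero -/

section NearZero

variable {β α : ℝ}

/-- The smallest point of a periodic orbit belongs to the bifurcation set. -/
theorem exists_mem_bifurcationSet_of_isPeriodicPt {y : ℝ} {n : ℕ} (hy : y ∈ Ico (0 : ℝ) 1)
    (hper : Function.IsPeriodicPt (betaT β α) (n + 1) y)
    (hpos : ∀ j ≤ n, 0 < (betaT β α)^[j] y) : ∃ m ∈ bifurcationSet β α, 0 < m ∧ m ≤ y := by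
  obtain ⟨j, hj, hmin⟩ := Finset.exists_min_image (Finset.range (n + 1))
    (fun j => (betaT β α)^[j] y) ⟨0, by simp⟩
  refine ⟨(betaT β α)^[j] y, mem_bifurcationSet.2 ⟨betaT_iterate_mem hy j, fun k => ?_⟩,
    hpos j (by simpa [Nat.lt_succ_iff] using hj), hmin 0 (by simp)⟩
  rw [← Function.iterate_add_apply, ← hper.iterate_mod_apply (k + j)]
  exact hmin _ (Finset.mem_range.2 (Nat.mod_lt _ n.succ_pos))

/-- The iterates of order `j ≤ n` are affine with slopes `β ^ j` on `[0, d)`. The length `d` is not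
required to be the largest possible. -/
def IsAffineBranch (β α : ℝ) (n : ℕ) (d : ℝ) : Prop :=
  0 < d ∧ d ≤ 1 ∧ ∀ x ∈ Ico (0 : ℝ) d, ∀ j ≤ n, (betaT β α)^[j] x = (betaT β α)^[j] 0 + β ^ j * x

theorem IsAffineBranch.mul_le_one (hβ : 1 < β) {n : ℕ} {d : ℝ} (hd : IsAffineBranch β α n d) :
    β ^ n * d ≤ 1 := by
  have hp : 0 < β ^ n := pow_pos (by linarith) n
  rw [← le_div_iff₀' hp]
  refine le_of_forall_lt_imp_le_of_dense fun x hx => ?_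
  rcases lt_or_ge x 0 with h0 | h0
  · exact h0.le.trans (by positivity)
  · have h1 := hd.2.2 x ⟨h0, hx⟩ n le_rfl
    have h2 := betaT_iterate_mem (β := β) (α := α) ⟨h0, hx.trans_le hd.2.1⟩ n
    have h3 := betaT_iterate_mem (β := β) (α := α) zero_mem_Ico n
    rw [le_div_iff₀' hp]
    linarith [h2.2, h3.1]

/-- When an affine branch at `0` is cut at the next iterate, the piece cut off is mapped onto an
interval starting at `0`. If the piece is not very short it contains a periodic point, which leads
to a bifurcation point. -/
theorem IsAffineBranch.step (h : IsBetaPair β α) {n : ℕ} {d : ℝ} (hd : IsAffineBranch β α n d) :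
    ∃ d', IsAffineBranch β α (n + 1) d' ∧
      (d * (1 - (β ^ (n + 1))⁻¹) ≤ d' ∨ ∃ m ∈ bifurcationSet β α, 0 < m ∧ m < d) := by
  obtain ⟨hd0, hd1, hd⟩ := hd
  have hpn := pow_pos h.pos n
  have hB : 1 < β ^ (n + 1) := one_lt_pow₀ h.one_lt n.succ_ne_zero
  have hBpos : 0 < β ^ (n + 1) := by linarith
  have hc := betaT_iterate_mem (β := β) (α := α) zero_mem_Ico n
  set c := (betaT β α)^[n] 0 with hcdef
  have hsucc : ∀ {d' : ℝ}, d' ≤ d →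
      (∀ x ∈ Ico (0 : ℝ) d', betaT β α (c + β ^ n * x) = betaT β α c + β ^ (n + 1) * x) →
      ∀ x ∈ Ico (0 : ℝ) d', ∀ j ≤ n + 1,
        (betaT β α)^[j] x = (betaT β α)^[j] 0 + β ^ j * x := by
    intro d' hd' hT x hx j hj
    have hxd : x ∈ Ico (0 : ℝ) d := ⟨hx.1, hx.2.trans_le hd'⟩
    rcases Nat.le_succ_iff.1 hj with hj | rfl
    · exact hd x hxd j hj
    · rw [Nat.succ_eq_add_one, Function.iterate_succ_apply', Function.iterate_succ_apply',
        hd x hxd n le_rfl, hT x hx]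
  have hmem : ∀ x ∈ Ico (0 : ℝ) d, c + β ^ n * x ∈ Ico (0 : ℝ) 1 := fun x hx => by
    rw [← hd x hx n le_rfl]
    exact betaT_iterate_mem ⟨hx.1, hx.2.trans_le hd1⟩ n
  by_cases hcut : c < betaCrit β α ∧ betaCrit β α < c + β ^ n * d
  · obtain ⟨hc1, hc2⟩ := hcut
    set a := (betaCrit β α - c) / β ^ n with ha
    have hac : c + β ^ n * a = betaCrit β α := by
      rw [ha, mul_div_cancel₀ _ hpn.ne']
      ring
    have ha0 : 0 < a := div_pos (by linarith) hpn
    have had : a < d := by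
      rw [ha, div_lt_iff₀ hpn]
      linarith
    refine ⟨a, ⟨ha0, had.le.trans hd1, hsucc had.le fun x hx => ?_⟩, ?_⟩
    · have h1 := mul_lt_mul_of_pos_left hx.2 hpn
      have h2 := hmem x ⟨hx.1, hx.2.trans had⟩
      rw [betaT_of_lt h h2.1 (by linarith), betaT_of_lt h hc.1 hc1]
      ring
    · rw [or_iff_not_imp_left, not_le]
      intro hlt
      -- the fixed point of the branch of the iterate `n + 1` to the right of the cut
      set y := a * β ^ (n + 1) / (β ^ (n + 1) - 1) with hy
      have hB1 : 0 < β ^ (n + 1) - 1 := by linarith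
      have hfix : β ^ (n + 1) * (y - a) = y := by
        rw [hy]
        field_simp
        ring
      have hya : a < y := by
        rw [hy, lt_div_iff₀ hB1]
        linarith
      have hyd : y < d := by
        rw [hy, div_lt_iff₀ hB1]
        have := mul_lt_mul_of_pos_right hlt hBpos
        rw [mul_assoc, sub_mul, inv_mul_cancel₀ hBpos.ne', one_mul] at this
        exact this
      have hyI : y ∈ Ico (0 : ℝ) d := ⟨(ha0.trans hya).le, hyd⟩
      have hper : Function.IsPeriodicPt (betaT β α) (n + 1) y := by
        have h1 := mul_lt_mul_of_pos_left hya hpn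
        rw [Function.IsPeriodicPt, Function.IsFixedPt, Function.iterate_succ_apply',
          hd y hyI n le_rfl, ← hcdef, betaT_of_ge h (by linarith) (hmem y hyI).2]
        have h2 := h.mul_crit
        rw [← hac] at h2
        rw [pow_succ] at hfix
        linarith
      obtain ⟨m, hm, hm0, hmy⟩ := exists_mem_bifurcationSet_of_isPeriodicPt
        ⟨hyI.1, hyd.trans_le hd1⟩ hper fun j hj => by
          rw [hd y hyI j hj]
          exact add_pos_of_nonneg_of_pos (betaT_iterate_mem zero_mem_Ico j).1
            (mul_pos (pow_pos h.pos j) (ha0.trans hya))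
      exact ⟨m, hm, hm0, hmy.trans_lt hyd⟩
  · refine ⟨d, ⟨hd0, hd1, hsucc le_rfl fun x hx => ?_⟩, Or.inl ?_⟩
    · have h2 := hmem x hx
      have h3 := mul_nonneg hpn.le hx.1
      rcases lt_or_ge c (betaCrit β α) with hc1 | hc1
      · have h1 := mul_lt_mul_of_pos_left hx.2 hpn
        have h4 : c + β ^ n * d ≤ betaCrit β α := not_lt.1 fun h5 => hcut ⟨hc1, h5⟩
        rw [betaT_of_lt h h2.1 (by linarith), betaT_of_lt h hc.1 hc1]
        ring
      · rw [betaT_of_ge h (by linarith) h2.2, betaT_of_ge h hc1 hc.2]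
        ring
    · exact mul_le_of_le_one_right hd0.le (sub_le_self _ (inv_nonneg.2 hBpos.le))

/-- If `0` were isolated, the branches at `0` would shrink only by factors tending to `1`, while
their lengths are at most `β ^ (-n)`. -/
theorem not_isIsolatedIn_zero (h : IsBetaPair β α) :
    ¬ IsIsolatedIn 0 (bifurcationSet β α) := by
  rintro ⟨-, δ, hδ, hiso⟩
  have hβ := h.one_lt
  have hinv := tendsto_inv_atTop_zero.comp (tendsto_pow_atTop_atTop_of_one_lt hβ)
  -- a rate `r < 1` with `β * r > 1`
  obtain ⟨r, hr1, hr2⟩ := exists_between (inv_lt_one_of_one_lt₀ hβ)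
  have hr0 : 0 < r := (inv_pos.2 h.pos).trans hr1
  obtain ⟨N, hN⟩ := (eventually_atTop.1
    ((hinv.eventually_lt_const hδ).and (hinv.eventually_lt_const (sub_pos.2 hr2))))
  have hstart : ∀ n, ∃ d, IsAffineBranch β α n d := by
    intro n
    induction n with
    | zero =>
      refine ⟨1, one_pos, le_rfl, fun x _ j hj => ?_⟩
      rw [Nat.le_zero.1 hj]
      simp
    | succ n ih =>
      obtain ⟨d, hd⟩ := ih
      obtain ⟨d', hd', -⟩ := hd.step h
      exact ⟨d', hd'⟩
  obtain ⟨d₀, hd₀⟩ := hstart N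
  have hslow : ∀ k, ∃ d, IsAffineBranch β α (N + k) d ∧ d₀ * r ^ k ≤ d := by
    intro k
    induction k with
    | zero => exact ⟨d₀, hd₀, by simp⟩
    | succ k ih =>
      obtain ⟨d, hd, hdr⟩ := ih
      obtain ⟨d', hd', hor⟩ := hd.step h
      refine ⟨d', hd', ?_⟩
      rcases hor with hle | ⟨m, hm, hm0, hmd⟩
      · have h1 : (β ^ (N + k + 1))⁻¹ < 1 - r := (hN (N + k + 1) (by omega)).2
        calc d₀ * r ^ (k + 1) = d₀ * r ^ k * r := by ring
          _ ≤ d * (1 - (β ^ (N + k + 1))⁻¹) :=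
            mul_le_mul hdr (by linarith) hr0.le hd.1.le
          _ ≤ d' := hle
      · have h1 : (β ^ (N + k))⁻¹ < δ := (hN (N + k) (by omega)).1
        have h2 : d ≤ (β ^ (N + k))⁻¹ := by
          rw [← one_div, le_div_iff₀' (pow_pos h.pos _)]
          exact hd.mul_le_one hβ
        have := hiso m hm (by rw [sub_zero, abs_of_pos hm0]; linarith)
        exact absurd this hm0.ne'
  have hgrow : 1 < β * r := by
    have := mul_lt_mul_of_pos_left hr1 h.pos
    rwa [mul_inv_cancel₀ h.pos.ne'] at this
  obtain ⟨k, hk⟩ :=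
    (((tendsto_pow_atTop_atTop_of_one_lt hgrow).const_mul_atTop hd₀.1).eventually_gt_atTop 1).exists
  obtain ⟨d, hd, hdr⟩ := hslow k
  have h1 := hd.mul_le_one hβ
  have h2 : β ^ k ≤ β ^ (N + k) := pow_le_pow_right₀ hβ.le (by omega)
  have h3 : β ^ k * (d₀ * r ^ k) ≤ β ^ (N + k) * d :=
    mul_le_mul h2 hdr (mul_pos hd₀.1 (pow_pos hr0 k)).le (pow_pos h.pos _).le
  rw [mul_pow] at hk
  linarith

end NearZero

/-! ### Isolated points and conclusion -/

theorem isIsolatedIn_greedyMap_iff {β α b : ℝ} (h : IsBetaPair β α) (hb : IsGreedyBase β α b)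
    {x : ℝ} (hx : x ∈ bifurcationSet β α) :
    IsIsolatedIn x (bifurcationSet β α) ↔
      IsIsolatedIn (greedyMap β α b x) (bifurcationSet b 0) := by
  have hp := hb.isBetaPair
  have hinj : InjOn (greedyMap β α b) (bifurcationSet β α) := fun y hy z hz he =>
    le_antisymm ((greedyMap_le_iff h hb hy.1 hz.1).1 he.le)
      ((greedyMap_le_iff h hb hz.1 hy.1).1 he.ge)
  constructor
  · intro hiso
    have hx0 : 0 < x := hx.1.1.lt_of_ne fun he => not_isIsolatedIn_zero h (he ▸ hiso)
    have hlt := (greedyMap_lt_iff h hb zero_mem_Ico hx.1).2 hx0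
    have hpos : 0 < greedyMap β α b x := (greedyMap_mem h hb zero_mem_Ico).1.trans_lt hlt
    have hgx := (greedyMap_mem_bifurcationSet_iff h hb hx.1).2 hx
    have hinv : ∀ y ∈ bifurcationSet β α,
        betaProj β α (upperExp b 0 (greedyMap β α b y)) = y := fun y hy => by
      rw [upperExp_greedyMap h hb hy.1, betaProj_upperExp h hy.1]
    have hcont : ContinuousAt (fun y => betaProj β α (upperExp b 0 y)) (greedyMap β α b x) :=
      (continuous_betaProj h.one_lt).continuousAt.comp (continuousAt_upperExp hp hgx hpos)
    -- the inverse is only defined on the part of the bifurcation set to the right of the image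
    -- of `0`, which is a neighbourhood of the image of `x` as `x > 0`
    have hiso' : IsIsolatedIn (greedyMap β α b x) (greedyMap β α b '' bifurcationSet β α) := by
      refine IsIsolatedIn.of_image (S' := bifurcationSet β α) (mem_image_of_mem _ hx)
        hcont.continuousWithinAt ?_ ?_ (by rwa [hinv x hx])
      · rintro _ ⟨y, hy, rfl⟩ _ ⟨z, hz, rfl⟩ he
        simp only [hinv y hy, hinv z hz] at he
        rw [he]
      · rintro _ ⟨y, hy, rfl⟩
        simp only [hinv y hy]
        exact hy
    obtain ⟨-, ε, hε, hiso'⟩ := hiso'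
    refine ⟨hgx, min ε (greedyMap β α b x - greedyMap β α b 0), lt_min hε (sub_pos.2 hlt),
      fun y hy hyx => hiso' y ?_ (hyx.trans_le (min_le_left _ _))⟩
    rw [greedyMap_image_bifurcationSet h hb]
    have := (abs_lt.1 (hyx.trans_le (min_le_right _ _))).1
    exact ⟨hy, by linarith, hy.1.2.le⟩
  · exact IsIsolatedIn.of_image hx
      ((continuous_betaProj hp.one_lt).continuousAt.comp_continuousWithinAt
        (continuousWithinAt_upperExp h hx)) hinj
      fun y hy => (greedyMap_mem_bifurcationSet_iff h hb hy.1).2 hy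

theorem mainTheorem7 (β α : ℝ) (hβα : (β, α) ∈ betaParam) :
    (∃! β' : ℝ, IsGreedyBase β α β') ∧
    ∀ β' : ℝ, IsGreedyBase β α β' →
      (β' < 2 ↔ α < 2 - β) ∧
      (greedyMap β α β' '' Ico (0 : ℝ) 1 = survivorSet β' 0 (greedyMap β α β' 0) ∧
        greedyMap β α β' '' bifurcationSet β α =
          bifurcationSet β' 0 ∩ Icc (greedyMap β α β' 0) 1) ∧
      (∀ x ∈ bifurcationSet β α,
        IsIsolatedIn x (bifurcationSet β α) ↔
          IsIsolatedIn (greedyMap β α β' x) (bifurcationSet β' 0)) ∧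
      (∀ t ∈ Ioo (0 : ℝ) 1,
        greedyMap β α β' '' survivorSet β α t = survivorSet β' 0 (greedyMap β α β' t)) ∧
      (∀ t ∈ Ioo (0 : ℝ) 1,
        dimH (survivorSet β α t) =
          ENNReal.ofReal (Real.log β' / Real.log β) *
            dimH (survivorSet β' 0 (greedyMap β α β' t))) := by
  obtain ⟨h1, h2, h3, h4⟩ := hβα
  have h : IsBetaPair β α := ⟨h1, h3, h4⟩
  refine ⟨existsUnique_isGreedyBase h, fun β' hb => ⟨hb.lt_two_iff h, ⟨?_, ?_⟩, ?_, ?_, ?_⟩⟩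
  · rw [← survivorSet_zero]
    exact greedyMap_image_survivorSet h hb zero_mem_Ico
  · exact greedyMap_image_bifurcationSet h hb
  · exact fun x hx => isIsolatedIn_greedyMap_iff h hb hx
  · exact fun t ht => greedyMap_image_survivorSet h hb (Ioo_subset_Ico_self ht)
  · exact fun t ht => dimH_survivorSet_eq h hb ht
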